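/- Let $\mathbf{Cat}$ be the category of small categories and $\mathbf{Grpd}$ its full subcategory of groupoids. Let $i:\mathbf{Grpd}\to\mathbf{Cat}$ be the inclusion and let $\pi:\mathbf{Cat}\to\mathbf{Grpd}$ be its left adjoint, the groupoidification functor ($\pi(C)$ is the free groupoid on $C$: it has the same objects as $C$ and all morphisms of $C$ are formally inverted). For an object $x$ of $C$ let $\pi_1(C,x)=\mathrm{Hom}_{\pi(C)}(x,x)$, and let $\pi_0(C)$ be the set of connected components of $C$. A model category is a category with all small limits and colimits and a (closed) model structure with functorial factorizations. Then the following hold. 1. There is a model structure on $\mathbf{Cat}$, the $1$-type model structure, in which a functor $f:C\to D$ is a weak equivalence iff the induced maps $\pi_0(C)\to\pi_0(D)$ and $\pi_1(C,x)\to\pi_1(D,f(x))$, for all objects $x$ of $C$, are bijections; a cofibration iff it is injective on objects; and a fibration iff it has the right lifting property with respect to all trivial cofibrations (functors that are both a cofibration and a weak equivalence). Write $\mathbf{Cat}_1$ for $\mathbf{Cat}$ with this model structure. 2. There is a model structure on $\mathbf{Grpd}$, the Anderson (canonical) model structure, in which a functor is a weak equivalence iff it is an equivalence of categories; a cofibration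 iff it is injective on objects; and a fibration iff it has the right lifting property with respect to $*\to S^\infty$, where $S^\infty$ is the groupoid with two objects $0,1$ and exactly one morphism between any two objects, and $*\mapsto 0$. 3. With these model structures $\pi:\mathbf{Cat}_1\rightleftarrows\mathbf{Grpd}:i$ is a pair of Quillen equivalences: $\pi$ preserves cofibrations, $i$ preserves fibrations, and for every cofibrant object $X$ of $\mathbf{Cat}_1$, every fibrant object $Y$ of $\mathbf{Grpd}$ and every functor $f:X\to iY$, $f$ is a weak equivalence in $\mathbf{Cat}_1$ iff the adjoint functor $f^\sharp:\pi X\to Y$ is a weak equivalence in $\mathbf{Grpd}$. -/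

import Mathlib

open CategoryTheory CategoryTheory.Limits HomotopicalAlgebra

universe u v₁ v₂ u₁ u₂

/-! ### Quillen pairs and Quillen equivalences -/

/-- A model category which moreover has all small limits and colimits and in which both
factorizations can be chosen functorially. -/
structure IsBicompleteFunctorialModel (M : Type u₁) [Category.{v₁} M] [ModelCategory M] :
    Prop where
  hasLimits : HasLimits M
  hasColimits : HasColimits M
  factorization_cofibration_trivialFibration :
    MorphismProperty.HasFunctorialFactorization (cofibrations M) (trivialFibrations M)
  factorization_trivialCofibration_fibration :
    MorphismProperty.HasFunctorialFactorization (trivialCofibrations M) (fibrations M)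

/-- An adjunction `F ⊣ G` between model categories is a Quillen pair if `F` preserves
cofibrations and `G` preserves fibrations. -/
structure IsQuillenPair {M : Type u₁} [Category.{v₁} M] [ModelCategory M]
    {N : Type u₂} [Category.{v₂} N] [ModelCategory N] {F : M ⥤ N} {G : N ⥤ M}
    (adj : F ⊣ G) : Prop where
  map_cofibration : ∀ {A B : M} (f : A ⟶ B), Cofibration f → Cofibration (F.map f)
  map_fibration : ∀ {X Y : N} (p : X ⟶ Y), Fibration p → Fibration (G.map p)

/-- A Quillen pair `F ⊣ G` is a pair of Quillen equivalences if for `X` cofibrant and `Y` fibrant,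
a map `X ⟶ G Y` is a weak equivalence iff its adjoint `F X ⟶ Y` is. -/
structure IsQuillenEquivalence {M : Type u₁} [Category.{v₁} M] [ModelCategory M]
    {N : Type u₂} [Category.{v₂} N] [ModelCategory N] {F : M ⥤ N} {G : N ⥤ M}
    (adj : F ⊣ G) : Prop extends IsQuillenPair adj where
  weakEquivalence_iff : ∀ (X : M) (Y : N), IsCofibrant X → IsFibrant Y → ∀ f : X ⟶ G.obj Y,
    WeakEquivalence f ↔ WeakEquivalence ((adj.homEquiv X Y).symm f)

/-! ### The 1-type model structure on small categories -/

/-- The map `π₁(C, x) ⟶ π₁(D, F x)` induced by a functor, where `π₁(C, x)` is the group of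
endomorphisms of `x` in the groupoidification (free groupoid) of `C`. -/
def fundamentalGroupMap {C : Type u₁} [Category.{v₁} C] {D : Type u₂} [Category.{v₂} D]
    (F : C ⥤ D) (x : C) :
    End (FreeGroupoid.mk x) → End (FreeGroupoid.mk (F.obj x)) :=
  fun g => (FreeGroupoid.map F).map g

/-- A functor is a weak 1-equivalence if it induces bijections on `π₀` and on `π₁` at every
base point. -/
structure IsWeakOneEquivalence {C : Type u₁} [Category.{v₁} C] {D : Type u₂} [Category.{v₂} D]
    (F : C ⥤ D) : Prop where
  bijective_pi_zero : Function.Bijective F.mapConnectedComponents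
  bijective_pi_one : ∀ x : C, Function.Bijective (fundamentalGroupMap F x)

/-- A model structure on small categories is the 1-type one if its weak equivalences are the weak
1-equivalences, its cofibrations are the functors injective on objects, and its fibrations are
the functors with the right lifting property for all trivial cofibrations. -/
structure IsOneTypeModelStructure (M : ModelCategory Cat.{u, u}) : Prop where
  weakEquivalence_iff : ∀ {C D : Cat.{u, u}} (f : C ⟶ D),
    WeakEquivalence f ↔ IsWeakOneEquivalence f.toFunctor
  cofibration_iff : ∀ {C D : Cat.{u, u}} (f : C ⟶ D),
    Cofibration f ↔ Function.Injective f.toFunctor.obj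
  fibration_iff : ∀ {C D : Cat.{u, u}} (f : C ⟶ D),
    Fibration f ↔ ∀ {A B : Cat.{u, u}} (i : A ⟶ B),
      Function.Injective i.toFunctor.obj → IsWeakOneEquivalence i.toFunctor →
        HasLiftingProperty i f

/-! ### The Anderson (canonical) model structure on groupoids -/

/-- The objects of the groupoid `0 ⇆ 1`. -/
inductive InfiniteSphere : Type u
  | zero
  | one

/-- The groupoid with two objects and exactly one morphism between any two objects. -/
instance : Groupoid.{u} InfiniteSphere.{u} where
  Hom _ _ := PUnit.{u + 1}
  id _ := PUnit.unit
  comp _ _ := PUnit.unit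
  inv _ := PUnit.unit

/-- The functor from the one-point groupoid to `0 ⇆ 1` that selects the object `0`. -/
def pointToInfiniteSphere :
    Grpd.of.{u, u} (Discrete PUnit.{u + 1}) ⟶ Grpd.of.{u, u} InfiniteSphere.{u} :=
  (Functor.const (Discrete PUnit.{u + 1})).obj InfiniteSphere.zero

/-- A model structure on groupoids is the Anderson one if its weak equivalences are the
equivalences of categories, its cofibrations are the functors injective on objects, and its
fibrations are the functors with the right lifting property for `* ⟶ (0 ⇆ 1)`. -/
structure IsAndersonModelStructure (N : ModelCategory Grpd.{u, u}) : Prop where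
  weakEquivalence_iff : ∀ {G H : Grpd.{u, u}} (f : G ⟶ H),
    WeakEquivalence f ↔ Functor.IsEquivalence (show G ⥤ H from f)
  cofibration_iff : ∀ {G H : Grpd.{u, u}} (f : G ⟶ H),
    Cofibration f ↔ Function.Injective (show G ⥤ H from f).obj
  fibration_iff : ∀ {G H : Grpd.{u, u}} (f : G ⟶ H),
    Fibration f ↔ HasLiftingProperty pointToInfiniteSphere.{u} f

/-! Everything is controlled by the free groupoid π(C). Its isomorphism classes of objects are the
components of C and its vertex groups are the π₁(C, x), so a functor f is a weak 1-equivalence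
exactly when π(f) is an equivalence (`isWeakOneEquivalence_iff`). Two-out-of-three and closure under
retracts are inherited from equivalences of groupoids, and the Quillen equivalence reduces to
invertibility of the counit.

What remains is two functorial factorizations. The projection of a `MappingCylinder` is fully
faithful and surjective on objects, so it lifts against every functor injective on objects. For the
other factorization, a functor of groupoids factors through its path groupoid, and injective
equivalences lift against isofibrations. For f : C ⥤ D in general, let E be the comma category of
π(f) and D → π(D), the pullback to D of the path groupoid of π(f); its projection to D lifts against
trivial cofibrations by adjunction (`Comma.exists_lift_snd`).

The hard point is that C → E is a weak equivalence, for which it suffices that π(E) → π(C) is an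
equivalence (`FreeGroupoid.isEquivalence_commaFst`). Morphisms of D act on E by postcomposition. In
π(E) this action becomes invertible, so the universal property of π(D) extends it to all morphisms
of π(D). The extended transport joins each object (x, d, φ) naturally to one base point over x,
which yields a quasi-inverse. -/

namespace CategoryTheory

/-! ### Lifting injective equivalences of groupoids against isofibrations -/

/-- A functor has isomorphism lifting if every morphism out of the image of an object lifts
(for groupoids, this says that the functor is an isofibration). -/
def Functor.LiftsMorphisms {X : Type u₁} [Category.{v₁} X] {Y : Type u₂} [Category.{v₂} Y]
    (p : X ⥤ Y) : Prop :=
  ∀ (x : X) (y : Y) (φ : p.obj x ⟶ y), ∃ (x' : X) (ψ : x ⟶ x') (h : p.obj x' = y),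
    p.map ψ ≫ eqToHom h = φ

section Lifting

variable {A B X Y : Type*} [Groupoid A] [Groupoid B] [Groupoid X] [Groupoid Y]
  {i : A ⥤ B} {p : X ⥤ Y} {u : A ⥤ X} {v : B ⥤ Y}

/-- The choices at an object `b` from which a lift in a square of groupoids is built. -/
structure LiftChoice [i.Full] (p : X ⥤ Y) (u : A ⥤ X) (v : B ⥤ Y) (sq : i ⋙ v = u ⋙ p) (b : B) where
  a : A
  e : i.obj a ⟶ b
  x : X
  ψ : u.obj a ⟶ x
  obj_eq : p.obj x = v.obj b
  map_eq : p.map ψ = eqToHom (Functor.congr_obj sq a).symm ≫ v.map e ≫ eqToHom obj_eq.symm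
  -- Over the image of `i` the choice is forced, so that the lift restricts to `u` strictly and not
  -- just up to isomorphism.
  fac : ∀ (a' : A) (h : i.obj a' = b), ∃ h' : u.obj a' = x,
    ψ = u.map (i.preimage (e ≫ eqToHom h.symm)) ≫ eqToHom h'

lemma LiftChoice.nonempty [i.Full] [i.Faithful] [i.EssSurj] (hi : Function.Injective i.obj)
    (hp : p.LiftsMorphisms) (sq : i ⋙ v = u ⋙ p) (b : B) : Nonempty (LiftChoice p u v sq b) := by
  by_cases hb : ∃ a, i.obj a = b
  · obtain ⟨a, rfl⟩ := hb
    refine ⟨⟨a, 𝟙 _, u.obj a, 𝟙 _, (Functor.congr_obj sq a).symm, by simp, ?_⟩⟩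
    intro a' h
    obtain rfl := hi h
    exact ⟨rfl, by simp⟩
  · obtain ⟨x, ψ, h, hψ⟩ := hp (u.obj (i.objPreimage b)) (v.obj b)
      (eqToHom (Functor.congr_obj sq _).symm ≫ v.map (i.objObjPreimageIso b).hom)
    refine ⟨⟨_, (i.objObjPreimageIso b).hom, x, ψ, h, ?_, fun a' h => (hb ⟨a', h⟩).elim⟩⟩
    rw [← cancel_mono (eqToHom h), hψ]
    simp

/-- The lift in a square of groupoids determined by a choice at each object. -/
@[simps]
noncomputable def liftOfChoices [i.Full] [i.Faithful] {sq : i ⋙ v = u ⋙ p}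
    (c : ∀ b, LiftChoice p u v sq b) : B ⥤ X where
  obj b := (c b).x
  map {b b'} m := inv (c b).ψ ≫ u.map (i.preimage ((c b).e ≫ m ≫ inv (c b').e)) ≫ (c b').ψ
  map_id b := by
    simp
  map_comp {b b' b''} m m' := by
    have : i.preimage ((c b).e ≫ (m ≫ m') ≫ inv (c b'').e) =
        i.preimage ((c b).e ≫ m ≫ inv (c b').e) ≫ i.preimage ((c b').e ≫ m' ≫ inv (c b'').e) :=
      i.map_injective (by simp)
    rw [this]
    simp

/-- Conjugating by the chosen `ψ` transports `u` along the equivalence `i`. The upper triangle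
commutes by `fac`, the lower one because `p.map ψ` is `v.map e` up to equality of objects. -/
lemma exists_lift_of_liftsMorphisms [i.IsEquivalence] (hi : Function.Injective i.obj)
    (hp : p.LiftsMorphisms) (sq : i ⋙ v = u ⋙ p) : ∃ l : B ⥤ X, i ⋙ l = u ∧ l ⋙ p = v := by
  have c : ∀ b, LiftChoice p u v sq b := fun b => (LiftChoice.nonempty hi hp sq b).some
  refine ⟨liftOfChoices c, ?_, ?_⟩
  · choose h' hψ using fun a => (c (i.obj a)).fac a rfl
    refine Functor.ext (fun a => (h' a).symm) fun a a' m => ?_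
    change inv (c (i.obj a)).ψ ≫ u.map (i.preimage
      ((c (i.obj a)).e ≫ i.map m ≫ inv (c (i.obj a')).e)) ≫ (c (i.obj a')).ψ =
        eqToHom (h' a).symm ≫ u.map m ≫ eqToHom (h' a')
    rw [IsIso.inv_comp_eq, hψ a, hψ a']
    simp only [Category.assoc, eqToHom_trans_assoc, eqToHom_refl, Category.id_comp,
      ← Functor.map_comp_assoc]
    congr 2
    exact i.map_injective (by simp)
  · refine Functor.ext (fun b => (c b).obj_eq) fun b b' m => ?_
    have key : ∀ {a a' : A} (k : a ⟶ a'), p.map (u.map k) =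
        eqToHom (Functor.congr_obj sq a).symm ≫ v.map (i.map k) ≫
          eqToHom (Functor.congr_obj sq a') := fun k => by
      simpa using Functor.congr_hom sq.symm k
    change p.map (inv (c b).ψ ≫ u.map (i.preimage
      ((c b).e ≫ m ≫ inv (c b').e)) ≫ (c b').ψ) =
        eqToHom (c b).obj_eq ≫ v.map m ≫ eqToHom (c b').obj_eq.symm
    rw [Functor.map_comp, Functor.map_inv, IsIso.inv_comp_eq]
    simp [key, (c _).map_eq]

end Lifting

/-! ### Strict functoriality of comma categories -/

lemma Comma.functor_ext {A B T Z : Type*} [Category A] [Category B] [Category T] [Category Z]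
    {L : A ⥤ T} {R : B ⥤ T} {S S' : Z ⥤ Comma L R}
    (h₁ : S ⋙ Comma.fst L R = S' ⋙ Comma.fst L R) (h₂ : S ⋙ Comma.snd L R = S' ⋙ Comma.snd L R)
    (h : ∀ z, HEq (S.obj z).hom (S'.obj z).hom) : S = S' := by
  have hobj : ∀ z, S.obj z = S'.obj z := fun z => by
    have e₁ := Functor.congr_obj h₁ z
    have e₂ := Functor.congr_obj h₂ z
    have e := h z
    dsimp at e₁ e₂
    generalize S.obj z = a at *
    generalize S'.obj z = b at *
    cases a; cases b
    subst e₁ e₂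
    cases e
    rfl
  refine Functor.ext hobj fun z z' m => ?_
  ext
  · simpa using Functor.congr_hom h₁ m
  · simpa using Functor.congr_hom h₂ m

/-- The functor between comma categories induced by strictly commuting squares. -/
@[simps]
def Comma.mapOfEq {A B T A' B' T' : Type*} [Category A] [Category B] [Category T]
    [Category A'] [Category B'] [Category T'] {L : A ⥤ T} {R : B ⥤ T} {L' : A' ⥤ T'} {R' : B' ⥤ T'}
    (a : A ⥤ A') (b : B ⥤ B') (t : T ⥤ T') (hL : L ⋙ t = a ⋙ L') (hR : R ⋙ t = b ⋙ R') :
    Comma L R ⥤ Comma L' R' where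
  obj z := ⟨a.obj z.left, b.obj z.right, eqToHom (Functor.congr_obj hL z.left).symm ≫
    t.map z.hom ≫ eqToHom (Functor.congr_obj hR z.right)⟩
  map {z z'} m :=
    { left := a.map m.left
      right := b.map m.right
      w := by
        have h₁ : L'.map (a.map m.left) = eqToHom (Functor.congr_obj hL z.left).symm ≫
          t.map (L.map m.left) ≫ eqToHom (Functor.congr_obj hL z'.left) :=
            Functor.congr_hom hL.symm m.left
        have h₂ : R'.map (b.map m.right) = eqToHom (Functor.congr_obj hR z.right).symm ≫
          t.map (R.map m.right) ≫ eqToHom (Functor.congr_obj hR z'.right) :=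
            Functor.congr_hom hR.symm m.right
        have h₃ : t.map (L.map m.left) ≫ t.map z'.hom = t.map z.hom ≫ t.map (R.map m.right) := by
          rw [← Functor.map_comp, m.w, Functor.map_comp]
        simp only [h₁, h₂, Category.assoc, eqToHom_trans_assoc, eqToHom_refl, Category.id_comp]
        rw [reassoc_of% h₃] }

noncomputable instance Comma.groupoid {A B T : Type*} [Groupoid A] [Groupoid B] [Groupoid T]
    (L : A ⥤ T) (R : B ⥤ T) : Groupoid (Comma L R) where
  inv f := { left := inv f.left, right := inv f.right }

/-! ### Equivalences, free groupoids and weak 1-equivalences -/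

section Equivalences

/-- A retract of an equivalence of categories is an equivalence. -/
lemma Functor.isEquivalence_of_retract {A B X Y : Type*} [Category A] [Category B] [Category X]
    [Category Y] {g : A ⥤ B} {f : X ⥤ Y} (i : A ⥤ X) (r : X ⥤ A) (j : B ⥤ Y) (s : Y ⥤ B)
    (hr : i ⋙ r = 𝟭 A) (hs : j ⋙ s = 𝟭 B) (hi : i ⋙ f = g ⋙ j) (hf : f ⋙ s = r ⋙ g)
    [f.IsEquivalence] : g.IsEquivalence :=
  (Equivalence.mk g (j ⋙ f.inv ⋙ r)
    (eqToIso hr.symm ≪≫ isoWhiskerLeft i (isoWhiskerRight f.asEquivalence.unitIso r) ≪≫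
      eqToIso (congrArg (· ⋙ f.inv ⋙ r) hi))
    (eqToIso (congrArg (j ⋙ f.inv ⋙ ·) hf.symm) ≪≫
      isoWhiskerLeft j (isoWhiskerRight f.asEquivalence.counitIso s) ≪≫
        eqToIso hs)).isEquivalence_functor

lemma FreeGroupoid.isEquivalence_map {C D : Type*} [Category C] [Category D] (F : C ⥤ D)
    [F.IsEquivalence] : (FreeGroupoid.map F).IsEquivalence :=
  (Equivalence.mk (FreeGroupoid.map F) (FreeGroupoid.map F.inv)
    (FreeGroupoid.liftNatIso _ _ (Functor.isoWhiskerRight F.asEquivalence.unitIso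
      (FreeGroupoid.of C)))
    (FreeGroupoid.liftNatIso _ _ (Functor.isoWhiskerRight F.asEquivalence.counitIso
      (FreeGroupoid.of D)))).isEquivalence_functor

lemma FreeGroupoid.nonempty_hom_iff_zigzag {C : Type*} [Category C] (x y : C) :
    Nonempty (FreeGroupoid.mk x ⟶ FreeGroupoid.mk y) ↔ Zigzag x y := by
  constructor
  · rintro ⟨f⟩
    -- The discrete category on the components is a groupoid, so the component map extends to the
    -- free groupoid.
    let L : FreeGroupoid C ⥤ Discrete (ConnectedComponents C) :=
      FreeGroupoid.lift (ConnectedComponents.functorToDiscrete _ id)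
    exact Quotient.exact (Discrete.eq_of_hom (L.map f))
  · intro h
    induction h with
    | refl => exact ⟨𝟙 _⟩
    | tail _ h ih =>
      obtain ⟨f⟩ := ih
      rcases h with ⟨⟨g⟩⟩ | ⟨⟨g⟩⟩
      · exact ⟨f ≫ FreeGroupoid.homMk g⟩
      · exact ⟨f ≫ inv (FreeGroupoid.homMk g)⟩

end Equivalences

end CategoryTheory

/-- A functor of groupoids is an equivalence iff it is bijective on components and on vertex groups;
the components of the free groupoid are those of the category by `nonempty_hom_iff_zigzag`. -/
lemma isWeakOneEquivalence_iff {C : Type u₁} [Category.{v₁} C] {D : Type u₂} [Category.{v₂} D]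
    (F : C ⥤ D) : IsWeakOneEquivalence F ↔ (FreeGroupoid.map F).IsEquivalence := by
  constructor
  · rintro ⟨⟨h₁, h₂⟩, h⟩
    have hom_of_hom (x y : C) (g : FreeGroupoid.mk (F.obj x) ⟶ FreeGroupoid.mk (F.obj y)) :
        Nonempty (FreeGroupoid.mk x ⟶ FreeGroupoid.mk y) := by
      have hxy : F.mapConnectedComponents (Quotient.mk _ x) =
          F.mapConnectedComponents (Quotient.mk _ y) :=
        Quotient.sound ((FreeGroupoid.nonempty_hom_iff_zigzag _ _).1 ⟨g⟩)
      exact (FreeGroupoid.nonempty_hom_iff_zigzag _ _).2 (Quotient.exact (h₁ hxy))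
    exact
      { faithful := ⟨fun {x y} f g hfg => by
          -- Parallel morphisms differ by a loop, which reduces faithfulness to injectivity on π₁.
          have : f ≫ inv g = 𝟙 x := (h x.as.as).1 (by
            change (FreeGroupoid.map F).map (f ≫ inv g) = (FreeGroupoid.map F).map (𝟙 x)
            rw [Functor.map_comp, hfg, ← Functor.map_comp, IsIso.hom_inv_id])
          simpa using this =≫ g⟩
        full := ⟨fun {x y} g => by
          -- Injectivity on π₀ supplies some morphism; surjectivity on π₁ supplies the loop that
          -- corrects it to a preimage of `g`.
          obtain ⟨f⟩ : Nonempty (x ⟶ y) := hom_of_hom x.as.as y.as.as g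
          obtain ⟨k, hk⟩ : ∃ k : x ⟶ x, (FreeGroupoid.map F).map k =
            g ≫ inv ((FreeGroupoid.map F).map f) := (h x.as.as).2 _
          exact ⟨k ≫ f, by
            rw [Functor.map_comp, hk, Category.assoc, IsIso.inv_hom_id, Category.comp_id]⟩⟩
        essSurj := ⟨fun y => by
          obtain ⟨x, hx⟩ := h₂ (Quotient.mk _ y.as.as)
          obtain ⟨x, rfl⟩ := Quotient.exists_rep x
          obtain ⟨g⟩ := (FreeGroupoid.nonempty_hom_iff_zigzag _ _).2 (Quotient.exact hx)
          exact ⟨FreeGroupoid.mk x, ⟨Groupoid.isoEquivHom _ _ |>.symm g⟩⟩⟩ }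
  · intro h
    refine ⟨⟨fun x y hxy => ?_, fun y => ?_⟩, fun x => ⟨fun f g hfg => ?_, fun g => ?_⟩⟩
    · obtain ⟨x, rfl⟩ := Quotient.exists_rep x
      obtain ⟨y, rfl⟩ := Quotient.exists_rep y
      obtain ⟨g⟩ := (FreeGroupoid.nonempty_hom_iff_zigzag _ _).2 (Quotient.exact hxy)
      exact Quotient.sound ((FreeGroupoid.nonempty_hom_iff_zigzag _ _).1
        ⟨(FreeGroupoid.map F).preimage g⟩)
    · obtain ⟨y, rfl⟩ := Quotient.exists_rep y
      exact ⟨Quotient.mk _ ((FreeGroupoid.map F).objPreimage (FreeGroupoid.mk y)).as.as,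
        Quotient.sound ((FreeGroupoid.nonempty_hom_iff_zigzag _ _).1
          ⟨((FreeGroupoid.map F).objObjPreimageIso (FreeGroupoid.mk y)).hom⟩)⟩
    · exact (FreeGroupoid.map F).map_injective hfg
    · exact (FreeGroupoid.map F).map_surjective (X := FreeGroupoid.mk x) (Y := FreeGroupoid.mk x) g

/-! ### The free groupoid on a comma category over D → π(D) -/

namespace CategoryTheory.FreeGroupoid

section Transport

variable {X : Type u₁} {D : Type u₂} [Groupoid.{v₁} X] [Category.{v₂} D] (F : X ⥤ FreeGroupoid D)

/-- The morphism in a comma category over `FreeGroupoid.of D` given by a morphism in `D`. -/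
@[simps]
def commaHomRight {x : X} {d d' : D} {φ : F.obj x ⟶ (of D).obj d} {φ' : F.obj x ⟶ (of D).obj d'}
    (b : d ⟶ d') (h : φ ≫ homMk b = φ') :
    (⟨x, d, φ⟩ : Comma F (of D)) ⟶ ⟨x, d', φ'⟩ where
  left := 𝟙 x
  right := b
  w := by simp [h]

/-- The morphism in a comma category over `FreeGroupoid.of D` given by a morphism in `X`. -/
@[simps]
def commaHomLeft {x x' : X} {d : D} {φ : F.obj x ⟶ (of D).obj d} {φ' : F.obj x' ⟶ (of D).obj d}
    (a : x ⟶ x') (h : F.map a ≫ φ' = φ) :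
    (⟨x, d, φ⟩ : Comma F (of D)) ⟶ ⟨x', d, φ'⟩ where
  left := a
  right := 𝟙 d
  w := by simp [h]

/-- The functor from the free groupoid on a comma category that forgets the second component. -/
noncomputable abbrev commaFst : FreeGroupoid (Comma F (of D)) ⥤ X :=
  lift (Comma.fst F (of D))

/-- Transport along a morphism `d ⟶ d'` in the free groupoid on `D`, in the free groupoid on a comma
category. -/
structure Transport (d d' : D) where
  hom : (of D).obj d ⟶ (of D).obj d'
  -- Taking `φ'` and the equation as arguments avoids casts between comma objects when transports
  -- are composed.
  app : ∀ (x : X) (φ : F.obj x ⟶ (of D).obj d) (φ' : F.obj x ⟶ (of D).obj d') (_ : φ ≫ hom = φ'),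
    (of (Comma F (of D))).obj ⟨x, d, φ⟩ ⟶ (of (Comma F (of D))).obj ⟨x, d', φ'⟩
  naturality : ∀ {x y : X} (a : x ⟶ y) (φ : F.obj x ⟶ (of D).obj d) (φ' : F.obj x ⟶ (of D).obj d')
    (χ : F.obj y ⟶ (of D).obj d) (χ' : F.obj y ⟶ (of D).obj d')
    (h : φ ≫ hom = φ') (k : χ ≫ hom = χ') (e : F.map a ≫ χ = φ) (e' : F.map a ≫ χ' = φ'),
    app x φ φ' h ≫ homMk (commaHomLeft F a e') = homMk (commaHomLeft F a e) ≫ app y χ χ' k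
  fst_app : ∀ x φ φ' h, (commaFst F).map (app x φ φ' h) = 𝟙 x

variable {F}

lemma Transport.ext' {d d' : D} {s t : Transport F d d'} (h : s.hom = t.hom)
    (happ : ∀ x φ φ' hs ht, s.app x φ φ' hs = t.app x φ φ' ht) : s = t := by
  obtain ⟨s, sa, _, _⟩ := s
  obtain ⟨t, ta, _, _⟩ := t
  obtain rfl : s = t := h
  obtain rfl : sa = ta := by
    funext x φ φ' h
    exact happ x φ φ' h h
  rfl

lemma Transport.app_congr {d d' : D} {s t : Transport F d d'} (hst : s = t) {x : X}
    {φ : F.obj x ⟶ (of D).obj d} {φ' : F.obj x ⟶ (of D).obj d'} (hs : φ ≫ s.hom = φ')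
    (ht : φ ≫ t.hom = φ') : s.app x φ φ' hs = t.app x φ φ' ht := by
  subst hst
  rfl

/-- The transport given by a morphism of `D`. -/
@[simps]
def Transport.ofHom {d d' : D} (b : d ⟶ d') : Transport F d d' where
  hom := homMk b
  app x φ φ' h := homMk (commaHomRight F b h)
  naturality a φ φ' χ χ' h k e e' := by
    rw [← Functor.map_comp, ← Functor.map_comp]
    congr 1
    ext <;> simp
  fst_app x φ φ' h := by simp

/-- The objects of `D`, with transports as morphisms. -/
structure TransportCat {X D : Type*} [Groupoid X] [Category D] (F : X ⥤ FreeGroupoid D) where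
  as : D

@[simp]
lemma commaHomRight_id {x : X} {d : D} {φ : F.obj x ⟶ (of D).obj d}
    (h : φ ≫ homMk (𝟙 d) = φ) : commaHomRight F (𝟙 d) h = 𝟙 _ := rfl

lemma Transport.id_comp_app {d d' : D} (s : Transport F d d') {x : X}
    {φ χ : F.obj x ⟶ (of D).obj d} {φ' : F.obj x ⟶ (of D).obj d'} (h : φ ≫ homMk (𝟙 d) = χ)
    (hs : χ ≫ s.hom = φ') (hs' : φ ≫ s.hom = φ') :
    homMk (commaHomRight F (𝟙 d) h) ≫ s.app x χ φ' hs = s.app x φ φ' hs' := by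
  obtain rfl : φ = χ := by simpa using h
  simp

lemma Transport.comp_id_app {d d' : D} (s : Transport F d d') {x : X}
    {φ : F.obj x ⟶ (of D).obj d} {χ φ' : F.obj x ⟶ (of D).obj d'} (h : χ ≫ homMk (𝟙 d') = φ')
    (hs : φ ≫ s.hom = χ) (hs' : φ ≫ s.hom = φ') :
    s.app x φ χ hs ≫ homMk (commaHomRight F (𝟙 d') h) = s.app x φ φ' hs' := by
  obtain rfl : χ = φ' := by simpa using h
  simp

lemma Transport.app_comp_inv_app {d d' : D} (s : Transport F d d') {x : X}
    {φ χ : F.obj x ⟶ (of D).obj d} {φ' : F.obj x ⟶ (of D).obj d'} (h : φ ≫ homMk (𝟙 d) = χ)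
    (hs : φ ≫ s.hom = φ') (hs' : χ ≫ s.hom = φ') :
    s.app x φ φ' hs ≫ inv (s.app x χ φ' hs') = homMk (commaHomRight F (𝟙 d) h) := by
  obtain rfl : φ = χ := by simpa using h
  simp

lemma Transport.inv_app_comp_app {d d' : D} (s : Transport F d d') {x : X}
    {φ : F.obj x ⟶ (of D).obj d} {χ φ' : F.obj x ⟶ (of D).obj d'} (h : χ ≫ homMk (𝟙 d') = φ')
    (hs : φ ≫ s.hom = χ) (hs' : φ ≫ s.hom = φ') :
    inv (s.app x φ χ hs) ≫ s.app x φ φ' hs' = homMk (commaHomRight F (𝟙 d') h) := by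
  obtain rfl : χ = φ' := by simpa using h
  simp

lemma Transport.app_comp_app {d d' d'' : D} (s : Transport F d d') (t : Transport F d' d'') {x : X}
    {φ : F.obj x ⟶ (of D).obj d} {χ χ' : F.obj x ⟶ (of D).obj d'}
    {φ' : F.obj x ⟶ (of D).obj d''} (hs : φ ≫ s.hom = χ) (ht : χ ≫ t.hom = φ')
    (hs' : φ ≫ s.hom = χ') (ht' : χ' ≫ t.hom = φ') :
    s.app x φ χ hs ≫ t.app x χ φ' ht = s.app x φ χ' hs' ≫ t.app x χ' φ' ht' := by
  obtain rfl : χ = χ' := hs.symm.trans hs'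
  rfl

instance : Category (TransportCat F) where
  Hom d d' := Transport F d.as d'.as
  id d := Transport.ofHom (𝟙 d.as)
  comp s t :=
    { hom := s.hom ≫ t.hom
      app := fun x φ φ' h => s.app x φ (φ ≫ s.hom) rfl ≫ t.app x _ φ' (by simp [h])
      naturality := fun a φ φ' χ χ' h k e e' => by
        rw [Category.assoc, t.naturality a _ _ (χ ≫ s.hom) _ _ (by simp [k]) (by simp [← e]) e',
          reassoc_of% (s.naturality a _ _ _ _ rfl rfl e)]
      fst_app := fun x φ φ' h => by
        rw [Functor.map_comp, s.fst_app, t.fst_app]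
        exact Category.id_comp (𝟙 x) }
  id_comp s := Transport.ext' (by simp) fun x φ φ' hs ht => s.id_comp_app _ _ _
  comp_id s := Transport.ext' (by simp) fun x φ φ' hs ht => s.comp_id_app _ _ _
  assoc s t r := Transport.ext' (by simp) fun x φ φ' hs ht =>
    (Category.assoc _ _ _).trans (congrArg (s.app _ _ _ rfl ≫ ·) (t.app_comp_app r _ _ _ _))

/-- Components of a transport lie in a free groupoid, hence are invertible. Being a groupoid is what
allows `toTransport` to extend from `D` to its free groupoid. -/
noncomputable instance : Groupoid (TransportCat F) where
  inv s :=
    { hom := inv s.hom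
      app := fun x φ φ' h => inv (s.app x φ' φ (by simp [← h]))
      naturality := fun a φ φ' χ χ' h k e e' => by
        rw [IsIso.inv_comp_eq, ← Category.assoc, IsIso.eq_comp_inv]
        exact (s.naturality a _ _ _ _ _ _ e' e).symm
      fst_app := fun x φ φ' h => by
        rw [Functor.map_inv]
        exact IsIso.inv_eq_of_hom_inv_id ((Category.comp_id _).trans (s.fst_app _ _ _ _)) }
  inv_comp s := Transport.ext' ((IsIso.inv_hom_id s.hom).trans ((of D).map_id _).symm)
    fun x φ φ' hs ht => s.inv_app_comp_app ht _ _
  comp_inv s := Transport.ext' ((IsIso.hom_inv_id s.hom).trans ((of D).map_id _).symm)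
    fun x φ φ' hs ht => s.app_comp_inv_app ht _ _

/-- A morphism of `D` acts by transport. -/
def toTransport (F : X ⥤ FreeGroupoid D) : D ⥤ TransportCat F where
  obj d := ⟨d⟩
  map b := Transport.ofHom b
  map_id _ := rfl
  map_comp b b' := Transport.ext' ((of D).map_comp b b') fun x φ φ' hs ht => by
    refine Eq.trans (congrArg homMk ?_) ((of (Comma F (of D))).map_comp _ _)
    ext
    · exact (Category.comp_id (𝟙 x)).symm
    · rfl

/-- The functor that forgets the action of a transport. -/
def transportHom (F : X ⥤ FreeGroupoid D) : TransportCat F ⥤ FreeGroupoid D where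
  obj d := (of D).obj d.as
  map s := s.hom
  map_id d := (of D).map_id d.as

/-- The transport given by a morphism of the free groupoid on `D`. -/
noncomputable def transport (F : X ⥤ FreeGroupoid D) {d d' : D}
    (ψ : (of D).obj d ⟶ (of D).obj d') : Transport F d d' :=
  (lift (toTransport F)).map ψ

/-- Both sides come from endofunctors of the free groupoid that agree on `D`, so uniqueness of lifts
applies. -/
lemma transport_hom {d d' : D} (ψ : (of D).obj d ⟶ (of D).obj d') :
    (transport F ψ).hom = ψ := by
  have : lift (toTransport F) ⋙ transportHom F = 𝟭 _ :=
    (lift_unique (of D) _ (by rw [← Functor.assoc, lift_spec]; rfl)).trans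
      (lift_unique (of D) _ rfl).symm
  exact (Functor.congr_hom this ψ).trans ((Category.id_comp _).trans (Category.comp_id _))

/-- The action of a morphism of the free groupoid on `D` in the free groupoid on a comma category
over `FreeGroupoid.of D`. -/
noncomputable def act {x : X} {d d' : D} (φ : F.obj x ⟶ (of D).obj d)
    (ψ : (of D).obj d ⟶ (of D).obj d') (φ' : F.obj x ⟶ (of D).obj d') (h : φ ≫ ψ = φ') :
    (of (Comma F (of D))).obj ⟨x, d, φ⟩ ⟶ (of (Comma F (of D))).obj ⟨x, d', φ'⟩ :=
  (transport F ψ).app x φ φ' (by rw [transport_hom, h])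

lemma act_homMk {x : X} {d d' : D} (φ : F.obj x ⟶ (of D).obj d) (b : d ⟶ d')
    (φ' : F.obj x ⟶ (of D).obj d') (h : φ ≫ homMk b = φ') :
    act φ (homMk b) φ' h = homMk (commaHomRight F b h) :=
  Transport.app_congr (t := Transport.ofHom b) (lift_map_homMk (toTransport F) b) _ h

lemma act_id {x : X} {d : D} (φ : F.obj x ⟶ (of D).obj d) (h) :
    act φ (𝟙 _) φ h = 𝟙 _ :=
  (Transport.app_congr (t := Transport.ofHom (𝟙 d)) ((lift (toTransport F)).map_id _) _
    (show φ ≫ homMk (𝟙 d) = φ by simp)).trans ((of (Comma F (of D))).map_id _)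

lemma act_comp {x : X} {d d' d'' : D} (φ : F.obj x ⟶ (of D).obj d)
    (ψ : (of D).obj d ⟶ (of D).obj d') (ψ' : (of D).obj d' ⟶ (of D).obj d'')
    (φ' : F.obj x ⟶ (of D).obj d') (φ'' : F.obj x ⟶ (of D).obj d'')
    (h : φ ≫ ψ = φ') (h' : φ' ≫ ψ' = φ'') (h'' : φ ≫ ψ ≫ ψ' = φ'') :
    act φ ψ φ' h ≫ act φ' ψ' φ'' h' = act φ (ψ ≫ ψ') φ'' h'' := by
  obtain rfl : φ ≫ ψ = φ' := h
  have h₁ : φ ≫ (transport F ψ).hom ≫ (transport F ψ').hom = φ'' := by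
    rw [transport_hom, transport_hom, h'']
  exact (Transport.app_comp_app _ _ _ _ rfl ((Category.assoc _ _ _).trans h₁)).trans
    (Transport.app_congr ((lift (toTransport F)).map_comp ψ ψ').symm h₁ _)

lemma act_naturality {x y : X} {d d' : D} (a : x ⟶ y) (ψ : (of D).obj d ⟶ (of D).obj d')
    (φ : F.obj x ⟶ (of D).obj d) (φ' : F.obj x ⟶ (of D).obj d')
    (χ : F.obj y ⟶ (of D).obj d) (χ' : F.obj y ⟶ (of D).obj d')
    (h : φ ≫ ψ = φ') (k : χ ≫ ψ = χ') (e : F.map a ≫ χ = φ) (e' : F.map a ≫ χ' = φ') :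
    act φ ψ φ' h ≫ homMk (commaHomLeft F a e') = homMk (commaHomLeft F a e) ≫ act χ ψ χ' k :=
  (transport F ψ).naturality a _ _ _ _ _ _ e e'

lemma commaFst_map_act {x : X} {d d' : D} (φ : F.obj x ⟶ (of D).obj d)
    (ψ : (of D).obj d ⟶ (of D).obj d') (φ' : F.obj x ⟶ (of D).obj d') (h : φ ≫ ψ = φ') :
    (commaFst F).map (act φ ψ φ' h) = 𝟙 x :=
  (transport F ψ).fst_app _ _ _ _

/-- The object of `D` underlying an object of its free groupoid. -/
def out (y : FreeGroupoid D) : D := y.as.as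

/-- The identity, as a morphism to the image of the underlying object. -/
def toOut (y : FreeGroupoid D) : y ⟶ (of D).obj y.out := 𝟙 y

variable (F) in
/-- The base point over `x` of the free groupoid on a comma category over `FreeGroupoid.of D`. -/
abbrev commaBase (x : X) : FreeGroupoid (Comma F (of D)) :=
  (of (Comma F (of D))).obj ⟨x, out (F.obj x), toOut (F.obj x)⟩

/-- The canonical morphism from the base point over `x` to an object over `x`. -/
noncomputable def commaPath {x : X} {d : D} (φ : F.obj x ⟶ (of D).obj d) :
    commaBase F x ⟶ (of (Comma F (of D))).obj ⟨x, d, φ⟩ :=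
  act (toOut (F.obj x)) (inv (toOut (F.obj x)) ≫ φ) φ (by simp)

lemma commaPath_comp_homRight {x : X} {d d' : D} {φ : F.obj x ⟶ (of D).obj d}
    {φ' : F.obj x ⟶ (of D).obj d'} (b : d ⟶ d') (h : φ ≫ homMk b = φ') :
    commaPath φ ≫ homMk (commaHomRight F b h) = commaPath φ' := by
  subst h
  rw [← act_homMk, commaPath, act_comp _ _ _ _ _ _ _ (by simp)]
  simp only [Category.assoc]
  rfl

variable (F) in
/-- A quasi-inverse of the first projection from the free groupoid on a comma category, on
morphisms. -/
noncomputable def commaSectionMap {x y : X} (a : x ⟶ y) : commaBase F x ⟶ commaBase F y :=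
  commaPath (F.map a ≫ toOut (F.obj y)) ≫ homMk (commaHomLeft F a rfl)

lemma commaSectionMap_eq {x y : X} (a : x ⟶ y) (φ : F.obj x ⟶ (of D).obj (out (F.obj y)))
    (h : F.map a ≫ toOut (F.obj y) = φ) :
    commaSectionMap F a = commaPath φ ≫ homMk (commaHomLeft F a h) := by
  subst h
  rfl

lemma commaSectionMap_comp_commaPath {x y : X} {d : D} (a : x ⟶ y) (χ : F.obj y ⟶ (of D).obj d)
    (φ : F.obj x ⟶ (of D).obj d) (h : F.map a ≫ χ = φ) :
    commaSectionMap F a ≫ commaPath χ = commaPath φ ≫ homMk (commaHomLeft F a h) := by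
  subst h
  rw [commaSectionMap, commaPath, commaPath, Category.assoc,
    ← act_naturality a _ (F.map a ≫ toOut (F.obj y)) (F.map a ≫ χ) _ _ (by simp) (by simp),
    ← Category.assoc, act_comp _ _ _ _ _ _ _ (by simp)]
  simp only [Category.assoc, IsIso.hom_inv_id_assoc]
  rfl

lemma commaPath_toOut (x : X) : commaPath (toOut (F.obj x)) = 𝟙 (commaBase F x) := by
  have : inv (toOut (F.obj x)) ≫ toOut (F.obj x) = 𝟙 _ := by simp
  simp only [commaPath, this, act_id]

lemma commaHomRight_comp_commaHomLeft {x y : X} {d d' : D} {φ : F.obj x ⟶ (of D).obj d}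
    {φ' : F.obj y ⟶ (of D).obj d'}
    (m : (⟨x, d, φ⟩ : Comma F (of D)) ⟶ ⟨y, d', φ'⟩) :
    homMk (commaHomRight F m.right rfl) ≫ homMk (commaHomLeft F m.left m.w) = homMk m := by
  rw [← Functor.map_comp]
  congr 1
  ext <;> simp

/-- This is naturality of `commaPath`: a comma morphism is one from `D` followed by one from `X`,
and each kind has been treated. -/
lemma commaSectionMap_comp_commaPath_of_hom {z z' : Comma F (of D)} (m : z ⟶ z') :
    commaSectionMap F m.left ≫ commaPath z'.hom = commaPath z.hom ≫ homMk m := by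
  rw [commaSectionMap_comp_commaPath _ _ _ m.w, ← commaHomRight_comp_commaHomLeft m,
    ← Category.assoc, commaPath_comp_homRight]

variable (F) in
/-- A quasi-inverse of the first projection from the free groupoid on a comma category. -/
noncomputable def commaSection : X ⥤ FreeGroupoid (Comma F (of D)) where
  obj x := commaBase F x
  map a := commaSectionMap F a
  map_id x := by
    have := commaSectionMap_comp_commaPath_of_hom
      (𝟙 (⟨x, out (F.obj x), toOut (F.obj x)⟩ : Comma F (of D)))
    simpa [commaPath_toOut] using this
  map_comp a b := by
    rename_i x y z
    obtain h : F.map (a ≫ b) ≫ toOut (F.obj z) = F.map a ≫ F.map b ≫ toOut (F.obj z) := by simp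
    have h' : homMk (commaHomLeft F (a ≫ b) h) =
        homMk (commaHomLeft F a rfl) ≫ homMk (commaHomLeft F b rfl) := by
      rw [← Functor.map_comp]
      congr 1
      ext <;> simp
    rw [commaSectionMap.eq_def F b, ← Category.assoc,
      commaSectionMap_comp_commaPath _ _ _ rfl, Category.assoc, ← h', commaSectionMap_eq _ _ h]

lemma commaFst_map_commaPath {x : X} {d : D} (φ : F.obj x ⟶ (of D).obj d) :
    (commaFst F).map (commaPath φ) = 𝟙 x :=
  commaFst_map_act _ _ _ _

/-- `commaPath` is the natural isomorphism from projecting and then taking the base point to the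
identity. The other composite is the identity, since transport is trivial on first components. -/
lemma isEquivalence_commaFst (F : X ⥤ FreeGroupoid D) : (commaFst F).IsEquivalence :=
  (Equivalence.mk (commaFst F) (commaSection F)
    (liftNatIso (commaFst F ⋙ commaSection F) (𝟭 _) (NatIso.ofComponents
      (fun z => (Groupoid.isoEquivHom _ _).symm (commaPath z.hom))
      (fun m => by
        refine Eq.trans ?_ (commaSectionMap_comp_commaPath_of_hom m)
        exact congrArg (fun a => commaSectionMap F a ≫ _) (lift_map_homMk _ m)))).symm
    (NatIso.ofComponents (fun x => Iso.refl _) (fun {x y} a => by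
      change (commaFst F).map (commaPath _ ≫ homMk (commaHomLeft F a rfl)) ≫ 𝟙 y = 𝟙 x ≫ a
      rw [Functor.map_comp, commaFst_map_commaPath, lift_map_homMk]
      exact Category.comp_id _))).isEquivalence_functor

end Transport

end CategoryTheory.FreeGroupoid

/-! ### Mapping cylinders -/

namespace CategoryTheory

section MappingCylinder

variable {C D Z : Type*} [Category C] [Category D] [Category Z]

/-- The mapping cylinder of a functor `f : C ⥤ D`: its objects are those of `C` and those of `D`,
its morphisms are the morphisms between the images in `D`. -/
structure MappingCylinder (f : C ⥤ D) where
  as : C ⊕ D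

namespace MappingCylinder

variable (f : C ⥤ D)

/-- The image in `D` of an object of the mapping cylinder. -/
def projObj {f : C ⥤ D} (x : MappingCylinder f) : D := Sum.elim f.obj id x.as

instance : Category (MappingCylinder f) where
  Hom x y := x.projObj ⟶ y.projObj
  id x := 𝟙 x.projObj
  comp g h := CategoryStruct.comp (obj := D) g h

instance {D : Type*} [Groupoid D] (f : C ⥤ D) : Groupoid (MappingCylinder f) where
  inv g := Groupoid.inv (obj := D) g
  inv_comp g := Groupoid.inv_comp (obj := D) g
  comp_inv g := Groupoid.comp_inv (obj := D) g

/-- The projection of the mapping cylinder. -/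
def proj : MappingCylinder f ⥤ D where
  obj x := x.projObj
  map g := g

/-- The inclusion in the mapping cylinder. -/
def incl : C ⥤ MappingCylinder f where
  obj c := ⟨Sum.inl c⟩
  map g := f.map g
  map_id := f.map_id
  map_comp := f.map_comp

lemma incl_comp_proj : incl f ⋙ proj f = f := rfl

lemma incl_obj_injective : Function.Injective (incl f).obj := fun _ _ h =>
  Sum.inl_injective (congrArg as h)

instance : (proj f).IsEquivalence where
  faithful := ⟨fun h => h⟩
  full := ⟨fun g => ⟨g, rfl⟩⟩
  essSurj := ⟨fun d => ⟨⟨Sum.inr d⟩, ⟨Iso.refl d⟩⟩⟩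

variable {f}

/-- The functor to a mapping cylinder determined by a functor to `D` and a lift on objects. -/
def lift (k : Z ⥤ D) (o : Z → MappingCylinder f) (h : ∀ z, (o z).projObj = k.obj z) :
    Z ⥤ MappingCylinder f where
  obj := o
  map {z z'} m := show (o z).projObj ⟶ (o z').projObj from
    eqToHom (h z) ≫ k.map m ≫ eqToHom (h z').symm
  map_id z := by
    change eqToHom (h z) ≫ k.map (𝟙 z) ≫ eqToHom (h z).symm = 𝟙 (o z).projObj
    simp
  map_comp {x y z} m m' := by
    change eqToHom (h x) ≫ k.map (m ≫ m') ≫ eqToHom (h z).symm =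
      (eqToHom (h x) ≫ k.map m ≫ eqToHom (h y).symm) ≫
        (eqToHom (h y) ≫ k.map m' ≫ eqToHom (h z).symm)
    simp

lemma lift_comp_proj (k : Z ⥤ D) (o : Z → MappingCylinder f)
    (h : ∀ z, (o z).projObj = k.obj z) : lift k o h ⋙ proj f = k :=
  Functor.ext h fun _ _ _ => rfl

lemma functor_ext {s t : Z ⥤ MappingCylinder f} (h : ∀ z, s.obj z = t.obj z)
    (hp : s ⋙ proj f = t ⋙ proj f) : s = t :=
  Functor.hext h fun _ _ m => Functor.hcongr_hom hp m

/-- Full faithfulness of the projection means that only objects must be chosen: prescribed on the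
image of `i`, and in the copy of `D` elsewhere. -/
lemma exists_lift {A B : Type*} [Category A] [Category B] {i : A ⥤ B}
    (hi : Function.Injective i.obj) {s : A ⥤ MappingCylinder f} {t : B ⥤ D}
    (sq : i ⋙ t = s ⋙ proj f) : ∃ l : B ⥤ MappingCylinder f, i ⋙ l = s ∧ l ⋙ proj f = t := by
  have ho : ∀ b, ∃ x : MappingCylinder f, x.projObj = t.obj b ∧ ∀ a, i.obj a = b → x = s.obj a := by
    intro b
    by_cases hb : ∃ a, i.obj a = b
    · obtain ⟨a, rfl⟩ := hb
      exact ⟨s.obj a, (Functor.congr_obj sq a).symm, fun a' h => by rw [hi h]⟩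
    · exact ⟨⟨Sum.inr (t.obj b)⟩, rfl, fun a h => (hb ⟨a, h⟩).elim⟩
  choose o h₁ h₂ using ho
  refine ⟨lift t o h₁, functor_ext (fun a => h₂ _ a rfl) ?_, lift_comp_proj _ _ _⟩
  rw [Functor.assoc, lift_comp_proj, sq]

/-- The functor between mapping cylinders induced by a commutative square. -/
def map {C' D' : Type*} [Category C'] [Category D'] {f' : C' ⥤ D'} (a : C ⥤ C') (b : D ⥤ D')
    (h : f ⋙ b = a ⋙ f') : MappingCylinder f ⥤ MappingCylinder f' :=
  lift (proj f ⋙ b) (fun x => ⟨Sum.map a.obj b.obj x.as⟩) (by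
    rintro ⟨c | d⟩
    · exact (Functor.congr_obj h c).symm
    · rfl)

lemma map_comp_proj {C' D' : Type*} [Category C'] [Category D'] {f' : C' ⥤ D'} (a : C ⥤ C')
    (b : D ⥤ D') (h : f ⋙ b = a ⋙ f') : map a b h ⋙ proj f' = proj f ⋙ b :=
  lift_comp_proj _ _ _

lemma incl_comp_map {C' D' : Type*} [Category C'] [Category D'] {f' : C' ⥤ D'} (a : C ⥤ C')
    (b : D ⥤ D') (h : f ⋙ b = a ⋙ f') : incl f ⋙ map a b h = a ⋙ incl f' :=
  functor_ext (fun _ => rfl) (by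
    rw [Functor.assoc, map_comp_proj, ← Functor.assoc, incl_comp_proj, h]
    rfl)

lemma map_id (h : f ⋙ 𝟭 D = 𝟭 C ⋙ f) : map (𝟭 C) (𝟭 D) h = 𝟭 _ :=
  functor_ext (by rintro ⟨c | d⟩ <;> rfl) (map_comp_proj _ _ _)

lemma map_comp {C' D' C'' D'' : Type*} [Category C'] [Category D'] [Category C''] [Category D'']
    {f' : C' ⥤ D'} {f'' : C'' ⥤ D''} (a : C ⥤ C') (b : D ⥤ D') (h : f ⋙ b = a ⋙ f')
    (a' : C' ⥤ C'') (b' : D' ⥤ D'') (h' : f' ⋙ b' = a' ⋙ f'')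
    (h'' : f ⋙ b ⋙ b' = (a ⋙ a') ⋙ f'') :
    map (a ⋙ a') (b ⋙ b') h'' = map a b h ⋙ map a' b' h' :=
  functor_ext (by rintro ⟨c | d⟩ <;> rfl) (by
    rw [map_comp_proj, Functor.assoc, map_comp_proj, ← Functor.assoc, ← Functor.assoc,
      map_comp_proj])

end MappingCylinder

end MappingCylinder

/-! ### Mapping path categories -/

section Comma

namespace Comma

/-- The equations are hypotheses because `FreeGroupoid.map` preserves identities only
propositionally. -/
lemma mapOfEq_id {A B T : Type*} [Category A] [Category B] [Category T] {L : A ⥤ T} {R : B ⥤ T}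
    {a : A ⥤ A} {b : B ⥤ B} {t : T ⥤ T} (ha : a = 𝟭 A) (hb : b = 𝟭 B) (ht : t = 𝟭 T)
    (hL : L ⋙ t = a ⋙ L) (hR : R ⋙ t = b ⋙ R) : mapOfEq a b t hL hR = 𝟭 _ := by
  subst ha hb ht
  exact functor_ext rfl rfl fun z => by
    simp only [mapOfEq_obj_hom, Functor.id_map]
    exact heq_of_eq ((Category.id_comp _).trans (Category.comp_id _))

lemma mapOfEq_comp {A B T A' B' T' A'' B'' T'' : Type*} [Category A] [Category B] [Category T]
    [Category A'] [Category B'] [Category T'] [Category A''] [Category B''] [Category T'']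
    {L : A ⥤ T} {R : B ⥤ T} {L' : A' ⥤ T'} {R' : B' ⥤ T'} {L'' : A'' ⥤ T''} {R'' : B'' ⥤ T''}
    {a : A ⥤ A'} {b : B ⥤ B'} {t : T ⥤ T'} {a' : A' ⥤ A''} {b' : B' ⥤ B''} {t' : T' ⥤ T''}
    {a'' : A ⥤ A''} {b'' : B ⥤ B''} {t'' : T ⥤ T''}
    (ha : a'' = a ⋙ a') (hb : b'' = b ⋙ b') (ht : t'' = t ⋙ t')
    (hL : L ⋙ t = a ⋙ L') (hR : R ⋙ t = b ⋙ R') (hL' : L' ⋙ t' = a' ⋙ L'')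
    (hR' : R' ⋙ t' = b' ⋙ R'') (hL'' : L ⋙ t'' = a'' ⋙ L'') (hR'' : R ⋙ t'' = b'' ⋙ R'') :
    mapOfEq a'' b'' t'' hL'' hR'' = mapOfEq a b t hL hR ⋙ mapOfEq a' b' t' hL' hR' := by
  subst ha hb ht
  exact functor_ext rfl rfl fun z => heq_of_eq (by
    change eqToHom ((congrArg t'.obj (Functor.congr_obj hL z.left)).trans
        (Functor.congr_obj hL' (a.obj z.left))).symm ≫ t'.map (t.map z.hom) ≫
      eqToHom (congrArg t'.obj (Functor.congr_obj hR z.right) |>.trans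
        (Functor.congr_obj hR' (b.obj z.right))) =
      eqToHom (Functor.congr_obj hL' (a.obj z.left)).symm ≫
        t'.map (eqToHom (Functor.congr_obj hL z.left).symm ≫ t.map z.hom ≫
          eqToHom (Functor.congr_obj hR z.right)) ≫
            eqToHom (Functor.congr_obj hR' (b.obj z.right))
    simp [eqToHom_map])

variable {X Y D : Type*} [Groupoid X] [Groupoid Y] [Category D]

/-- The pullback of `Comma F (𝟭 Y)` along `K` is `Comma F K`. -/
@[simps]
def toIdRight (F : X ⥤ Y) (K : D ⥤ Y) : Comma F K ⥤ Comma F (𝟭 Y) where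
  obj z := ⟨z.left, K.obj z.right, z.hom⟩
  map m := { left := m.left, right := K.map m.right }

lemma snd_liftsMorphisms (F : X ⥤ Y) : (Comma.snd F (𝟭 Y)).LiftsMorphisms :=
  fun z y φ => ⟨⟨z.left, y, z.hom ≫ φ⟩, { left := 𝟙 _, right := φ }, rfl, by simp⟩

/-- The inclusion of `C` in the mapping path category. -/
@[simps]
def ofSquare {C : Type*} [Category C] {F : X ⥤ Y} {K : D ⥤ Y} (s : C ⥤ X) (t : C ⥤ D)
    (h : s ⋙ F = t ⋙ K) : C ⥤ Comma F K where
  obj c := ⟨s.obj c, t.obj c, eqToHom (Functor.congr_obj h c)⟩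
  map m :=
    { left := s.map m
      right := t.map m
      w := by
        have := Functor.congr_hom h m
        dsimp at this
        simp [this] }

lemma comp_ofSquare {C C' X' Y' D' : Type*} [Category C] [Category C'] [Groupoid X'] [Groupoid Y']
    [Category D'] {F : X ⥤ Y} {K : D ⥤ Y} {F' : X' ⥤ Y'} {K' : D' ⥤ Y'} {s : C ⥤ X} {t : C ⥤ D}
    (h : s ⋙ F = t ⋙ K) {s' : C' ⥤ X'} {t' : C' ⥤ D'} (h' : s' ⋙ F' = t' ⋙ K')
    {a : X ⥤ X'} {b : D ⥤ D'} {c : Y ⥤ Y'} (hF : F ⋙ c = a ⋙ F') (hK : K ⋙ c = b ⋙ K')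
    {r : C ⥤ C'} (hs : r ⋙ s' = s ⋙ a) (ht : r ⋙ t' = t ⋙ b) :
    r ⋙ ofSquare s' t' h' = ofSquare s t h ⋙ mapOfEq a b c hF hK := by
  have hst : (s ⋙ a) ⋙ F' = (t ⋙ b) ⋙ K' := by rw [← hs, ← ht, Functor.assoc, h', Functor.assoc]
  trans ofSquare (s ⋙ a) (t ⋙ b) hst
  · simp only [← hs, ← ht]
    rfl
  · refine functor_ext rfl rfl fun z => heq_of_eq ?_
    change eqToHom ((Functor.congr_obj hF (s.obj z)).symm.trans
        ((congrArg c.obj (Functor.congr_obj h z)).trans (Functor.congr_obj hK (t.obj z)))) =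
      eqToHom (Functor.congr_obj hF (s.obj z)).symm ≫ c.map (eqToHom (Functor.congr_obj h z)) ≫
        eqToHom (Functor.congr_obj hK (t.obj z))
    simp [eqToHom_map]

lemma isEquivalence_ofSquare_id (F : X ⥤ Y) : (ofSquare (K := 𝟭 Y) (𝟭 X) F rfl).IsEquivalence :=
  (Equivalence.mk (ofSquare (K := 𝟭 Y) (𝟭 X) F rfl) (Comma.fst F (𝟭 Y)) (Iso.refl _)
    (NatIso.ofComponents (fun z => (Groupoid.isoEquivHom _ _).symm
      { left := 𝟙 z.left, right := z.hom, w := congrArg (· ≫ z.hom) (F.map_id z.left) })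
      (fun m => by
        ext
        · exact (Category.comp_id _).trans (Category.id_comp _).symm
        · exact m.w))).isEquivalence_functor

/-- `Comma F K` is the pullback along `K` of the groupoid `Comma F (𝟭 Y)`. By the universal property
of free groupoids the problem there becomes one for `FreeGroupoid.map i` against an isofibration. -/
lemma exists_lift_snd {A B : Type*} [Category A] [Category B] {F : X ⥤ Y} {K : D ⥤ Y} {i : A ⥤ B}
    [(FreeGroupoid.map i).IsEquivalence] (hi : Function.Injective i.obj)
    {s : A ⥤ Comma F K} {t : B ⥤ D} (sq : i ⋙ t = s ⋙ Comma.snd F K) :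
    ∃ l : B ⥤ Comma F K, i ⋙ l = s ∧ l ⋙ Comma.snd F K = t := by
  obtain ⟨l, h₁, h₂⟩ := exists_lift_of_liftsMorphisms (i := FreeGroupoid.map i)
    (u := FreeGroupoid.lift (s ⋙ toIdRight F K)) (v := FreeGroupoid.lift (t ⋙ K))
    (fun x y h => by
      obtain ⟨x, rfl⟩ := FreeGroupoid.of_obj_bijective.2 x
      obtain ⟨y, rfl⟩ := FreeGroupoid.of_obj_bijective.2 y
      exact congrArg _ (hi (FreeGroupoid.of_obj_bijective.1 h))) (snd_liftsMorphisms F) (by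
      rw [FreeGroupoid.map_comp_lift, ← FreeGroupoid.lift_comp, ← Functor.assoc, sq]
      rfl)
  replace h₁ : i ⋙ FreeGroupoid.of B ⋙ l = s ⋙ toIdRight F K := by
    rw [← FreeGroupoid.lift_spec (s ⋙ toIdRight F K), ← h₁]
    rfl
  replace h₂ : (FreeGroupoid.of B ⋙ l) ⋙ Comma.snd F (𝟭 Y) = t ⋙ K := by
    rw [← FreeGroupoid.lift_spec (t ⋙ K), ← h₂]
    rfl
  generalize FreeGroupoid.of B ⋙ l = l' at h₁ h₂
  -- The pullback is formed by hand: left components come from `l'`, right components from `t`.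
  refine ⟨
    { obj := fun b => ⟨(l'.obj b).left, t.obj b, (l'.obj b).hom ≫ eqToHom (Functor.congr_obj h₂ b)⟩
      map := fun {b b'} m =>
        { left := (l'.map m).left
          right := t.map m
          w := by
            have h₃ := (l'.map m).w
            have h₄ := Functor.congr_hom h₂ m
            dsimp at h₃
            replace h₄ : (l'.map m).right = eqToHom (Functor.congr_obj h₂ b) ≫ K.map (t.map m) ≫
              eqToHom (Functor.congr_obj h₂ b').symm := h₄
            rw [reassoc_of% h₃, h₄]
            simp } }, functor_ext ?_ sq ?_, rfl⟩
  · exact congrArg (· ⋙ Comma.fst F (𝟭 Y)) h₁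
  · intro a
    have h₃ := Functor.congr_obj h₁ a
    dsimp at h₃ ⊢
    refine (comp_eqToHom_heq _ _).trans ?_
    rw [h₃]
    rfl

end Comma

end Comma

end CategoryTheory

/-! ### Model structures from functorial factorizations -/

namespace HomotopicalAlgebra.ModelCategory

open MorphismProperty

variable {C : Type u₁} [Category.{v₁} C] {cof W fib : MorphismProperty C}

/-- If every map factors as a cofibration followed by a weak equivalence with the right lifting
property for cofibrations, then trivial fibrations have that lifting property. -/
lemma trivialFibrations_le_rlp [W.HasTwoOutOfThreeProperty] (hfib : fib = (cof ⊓ W).rlp)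
    (d : FactorizationData cof (cof.rlp ⊓ W)) : fib ⊓ W ≤ cof.rlp := by
  intro X Y p ⟨hp, hW⟩
  have hd := d p
  -- Retract argument: `hd.i` is a trivial cofibration, so `p` lifts against it and is a retract of
  -- `hd.p`.
  have hi : W hd.i := W.of_postcomp hd.i hd.p hd.hp.2 (by rwa [hd.fac])
  rw [hfib] at hp
  have := hp hd.i ⟨hd.hi, hi⟩
  have sq : CommSq (𝟙 X) hd.i p hd.p := ⟨by simp⟩
  have r : RetractArrow p hd.p :=
    { i := Arrow.homMk hd.i (𝟙 Y)
      r := Arrow.homMk sq.lift (𝟙 Y) }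
  exact of_retract r hd.hp.1

/-- A model structure from cofibrations and weak equivalences, where the fibrations are the maps
with the right lifting property for trivial cofibrations. -/
@[reducible]
def ofFunctorialFactorizations [HasFiniteLimits C] [HasFiniteColimits C]
    [W.HasTwoOutOfThreeProperty] [W.IsStableUnderRetracts] [cof.IsStableUnderRetracts]
    (hfib : fib = (cof ⊓ W).rlp)
    (d₁ : FunctorialFactorizationData cof (cof.rlp ⊓ W))
    (d₂ : FunctorialFactorizationData (cof ⊓ W) fib) : ModelCategory C where
  categoryWithFibrations := ⟨fib⟩
  categoryWithCofibrations := ⟨cof⟩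
  categoryWithWeakEquivalences := ⟨W⟩
  cm2 := inferInstanceAs W.HasTwoOutOfThreeProperty
  cm3a := inferInstanceAs W.IsStableUnderRetracts
  cm3b := show fib.IsStableUnderRetracts by rw [hfib]; infer_instance
  cm3c := inferInstanceAs cof.IsStableUnderRetracts
  cm4a i p hi hw hp := by
    obtain ⟨hi⟩ := hi
    obtain ⟨hw⟩ := hw
    obtain ⟨hp⟩ := hp
    replace hp : fib p := hp
    rw [hfib] at hp
    exact hp i ⟨hi, hw⟩
  cm4b i p hi hp hw :=
    trivialFibrations_le_rlp hfib d₁.factorizationData p ⟨hp.mem, hw.mem⟩ i hi.mem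
  cm5a := ⟨fun f => ⟨d₂.factorizationData f⟩⟩
  cm5b := ⟨fun f => ⟨((d₁.ofLE le_rfl fun _ _ p hp => ⟨by
    rw [hfib]
    exact fun _ _ i hi => hp.1 i hi.1, hp.2⟩ :
      FunctorialFactorizationData cof (fib ⊓ W))).factorizationData f⟩⟩

lemma isBicompleteFunctorialModel_of [HasLimits C] [HasColimits C]
    [W.HasTwoOutOfThreeProperty] [W.IsStableUnderRetracts] [cof.IsStableUnderRetracts]
    (hfib : fib = (cof ⊓ W).rlp)
    (d₁ : FunctorialFactorizationData cof (cof.rlp ⊓ W))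
    (d₂ : FunctorialFactorizationData (cof ⊓ W) fib) :
    letI := ofFunctorialFactorizations hfib d₁ d₂
    IsBicompleteFunctorialModel C :=
  letI := ofFunctorialFactorizations hfib d₁ d₂
  { hasLimits := inferInstance
    hasColimits := inferInstance
    factorization_cofibration_trivialFibration := ⟨⟨d₁.ofLE le_rfl fun _ _ p hp => ⟨by
      change fib p
      rw [hfib]
      exact fun _ _ i hi => hp.1 i hi.1, hp.2⟩⟩⟩
    factorization_trivialCofibration_fibration := ⟨⟨d₂⟩⟩ }

end HomotopicalAlgebra.ModelCategory

namespace CategoryTheory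

open MorphismProperty

/-! ### Groupoids: isofibrations and factorizations -/

namespace Grpd

/-- The functor underlying a morphism of groupoids. -/
abbrev toFunctor {G H : Grpd.{u, u}} (f : G ⟶ H) : G ⥤ H := f

/-- The functors between groupoids that are injective on objects. -/
def injectiveOnObjects : MorphismProperty Grpd.{u, u} :=
  fun _ _ f => Function.Injective (toFunctor f).obj

/-- The equivalences of groupoids. -/
def equivalences : MorphismProperty Grpd.{u, u} :=
  fun _ _ f => Functor.IsEquivalence (toFunctor f)

/-- The isofibrations of groupoids. -/
def isofibrations : MorphismProperty Grpd.{u, u} :=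
  fun _ _ f => (toFunctor f).LiftsMorphisms

instance : HasLimits Grpd.{u, u} := hasLimits_of_reflective Grpd.forgetToCat

instance : HasColimits Grpd.{u, u} := hasColimits_of_reflective Grpd.forgetToCat

instance : equivalences.{u}.HasTwoOutOfThreeProperty where
  comp_mem {X Y Z} f g hf hg := by
    have : Functor.IsEquivalence (toFunctor f) := hf
    have : Functor.IsEquivalence (toFunctor g) := hg
    exact Functor.isEquivalence_trans (toFunctor f) (toFunctor g)
  of_postcomp {X Y Z} f g hg hfg := by
    have : Functor.IsEquivalence (toFunctor g) := hg
    have : Functor.IsEquivalence ((toFunctor f) ⋙ (toFunctor g)) := hfg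
    exact Functor.isEquivalence_of_comp_right (toFunctor f) (toFunctor g)
  of_precomp {X Y Z} f g hf hfg := by
    have : Functor.IsEquivalence (toFunctor f) := hf
    have : Functor.IsEquivalence ((toFunctor f) ⋙ (toFunctor g)) := hfg
    exact Functor.isEquivalence_of_comp_left (toFunctor f) (toFunctor g)

instance : equivalences.{u}.IsStableUnderRetracts where
  of_retract {X Y Z W} f g h hg := by
    have : Functor.IsEquivalence (toFunctor g) := hg
    exact Functor.isEquivalence_of_retract (toFunctor h.i.left) (toFunctor h.r.left)
      (toFunctor h.i.right) (toFunctor h.r.right) h.retract_left h.retract_right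
      h.i_w h.r_w.symm

instance : injectiveOnObjects.{u}.IsStableUnderRetracts where
  of_retract {X Y Z W} f g h hg x y hxy := by
    have h₁ : ∀ x : X, (toFunctor (h.i.left ≫ g)).obj x = (toFunctor (f ≫ h.i.right)).obj x :=
      fun x => by rw [h.i_w]
    have h₂ : (toFunctor h.i.left).obj x = (toFunctor h.i.left).obj y :=
      hg ((h₁ x).trans ((congrArg (toFunctor h.i.right).obj hxy).trans (h₁ y).symm))
    have h₃ : (toFunctor h.i.left) ⋙ (toFunctor h.r.left) = 𝟭 X := h.retract_left
    simpa [← Functor.comp_obj, h₃] using congrArg (toFunctor h.r.left).obj h₂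

lemma isofibrations_le_rlp : isofibrations.{u} ≤ (injectiveOnObjects ⊓ equivalences).rlp := by
  intro X Y p hp A B i hi
  have : Functor.IsEquivalence (toFunctor i) := hi.2
  refine ⟨fun {s t} sq => ?_⟩
  obtain ⟨l, h₁, h₂⟩ := exists_lift_of_liftsMorphisms (i := (toFunctor i))
    (p := (toFunctor p)) (u := s) (v := t) hi.1 hp sq.w.symm
  exact ⟨⟨⟨l, h₁, h₂⟩⟩⟩

lemma pointToInfiniteSphere_mem :
    (injectiveOnObjects ⊓ equivalences) pointToInfiniteSphere.{u} :=
  ⟨fun (x y : Discrete PUnit) _ => Subsingleton.elim x y,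
    { faithful := ⟨fun {x y : Discrete PUnit} (f g : x ⟶ y) _ => Subsingleton.elim f g⟩
      full := ⟨fun {x y : Discrete PUnit} _ =>
        ⟨(eqToHom (Subsingleton.elim x y) : x ⟶ y), rfl⟩⟩
      essSurj := ⟨fun _ => ⟨(⟨PUnit.unit⟩ : Discrete PUnit),
        ⟨⟨PUnit.unit, PUnit.unit, rfl, rfl⟩⟩⟩⟩ }⟩

/-- The functor from the groupoid `0 ⇆ 1` given by a morphism of a groupoid. -/
noncomputable def ofHom {X : Type u} [Groupoid.{u} X] {x y : X} (f : x ⟶ y) :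
    InfiniteSphere.{u} ⥤ X where
  obj
    | .zero => x
    | .one => y
  map {a b} _ := match a, b with
    | .zero, .zero => 𝟙 x
    | .zero, .one => f
    | .one, .zero => inv f
    | .one, .one => 𝟙 y
  map_id a := by cases a <;> rfl
  map_comp {a b c} _ _ := by cases a <;> cases b <;> cases c <;> simp

lemma exists_lift_of_comp_eq_ofHom {X Y : Type u} [Groupoid.{u} X] [Groupoid.{u} Y] {p : X ⥤ Y}
    {x : X} {y : Y} {φ : p.obj x ⟶ y} {l : InfiniteSphere.{u} ⥤ X} (h : l ⋙ p = ofHom φ)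
    (hx : l.obj .zero = x) :
    ∃ (x' : X) (ψ : x ⟶ x') (h : p.obj x' = y), p.map ψ ≫ eqToHom h = φ := by
  refine ⟨l.obj .one, eqToHom hx.symm ≫ l.map PUnit.unit, Functor.congr_obj h .one, ?_⟩
  have h' : p.map (l.map (X := .zero) (Y := .one) PUnit.unit) =
    eqToHom (congrArg p.obj hx) ≫ φ ≫ eqToHom (Functor.congr_obj h .one).symm :=
      Functor.congr_hom h (X := .zero) (Y := .one) PUnit.unit
  subst hx
  generalize_proofs h₁ h₂ at h'
  rw [eqToHom_refl, Category.id_comp, h', eqToHom_refl, Category.id_comp,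
    Category.assoc]
  exact (congrArg (φ ≫ ·) (eqToHom_trans h₂ _)).trans (Category.comp_id φ)

/-- A morphism of a groupoid is a functor from `0 ⇆ 1`; a lift of that functor, evaluated at `0 ⟶
1`, lifts the morphism. -/
lemma mem_isofibrations_of_hasLiftingProperty {X Y : Grpd.{u, u}} (p : X ⟶ Y)
    [HasLiftingProperty pointToInfiniteSphere.{u} p] : isofibrations p := by
  intro x y φ
  let s : Grpd.of.{u, u} (Discrete PUnit.{u + 1}) ⟶ X := (Functor.const (Discrete PUnit)).obj x
  let t : Grpd.of.{u, u} InfiniteSphere.{u} ⟶ Y := ofHom φ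
  have sq : CommSq s pointToInfiniteSphere p t := ⟨Functor.ext (fun _ => rfl) fun a b f => by
    refine Eq.trans ((toFunctor p).map_id x) ?_
    exact ((Category.id_comp _).trans (Category.comp_id _)).symm⟩
  exact exists_lift_of_comp_eq_ofHom (l := sq.lift) sq.fac_right
    (Functor.congr_obj sq.fac_left (⟨PUnit.unit⟩ : Discrete PUnit))

lemma isofibrations_eq_rlp : isofibrations.{u} = (injectiveOnObjects ⊓ equivalences).rlp :=
  le_antisymm isofibrations_le_rlp fun _ _ p hp =>
    have := hp _ pointToInfiniteSphere_mem
    mem_isofibrations_of_hasLiftingProperty p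

/-- Functors between groupoids factor through mapping cylinders. -/
def mappingCylinderFactorization : FunctorialFactorizationData injectiveOnObjects.{u}
    (injectiveOnObjects.rlp ⊓ equivalences) where
  Z :=
    { obj f := Grpd.of (MappingCylinder (toFunctor f.hom))
      map φ := MappingCylinder.map φ.left φ.right φ.w.symm
      map_id f := MappingCylinder.map_id _
      map_comp φ ψ := MappingCylinder.map_comp _ _ _ _ _ _ _ }
  i := { app f := MappingCylinder.incl (toFunctor f.hom)
         naturality f g φ := (MappingCylinder.incl_comp_map _ _ φ.w.symm).symm }
  p := { app f := MappingCylinder.proj (toFunctor f.hom)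
         naturality f g φ := MappingCylinder.map_comp_proj _ _ φ.w.symm }
  fac := rfl
  hi f := MappingCylinder.incl_obj_injective _
  hp f := ⟨fun A B i hi => ⟨fun {s t} sq => by
      obtain ⟨l, h₁, h₂⟩ := MappingCylinder.exists_lift (i := (toFunctor i)) hi
        (f := (toFunctor f.hom)) (s := s) (t := t) sq.w.symm
      exact ⟨⟨⟨l, h₁, h₂⟩⟩⟩⟩,
    (inferInstance : (MappingCylinder.proj (toFunctor f.hom)).IsEquivalence)⟩

/-- Functors between groupoids factor through mapping path groupoids. -/
noncomputable def pathFactorization : FunctorialFactorizationData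
    (injectiveOnObjects.{u} ⊓ equivalences) isofibrations where
  Z :=
    { obj f := Grpd.of (Comma (toFunctor f.hom) (𝟭 f.right))
      map φ := Comma.mapOfEq φ.left φ.right φ.right φ.w.symm rfl
      map_id f := Comma.mapOfEq_id rfl rfl rfl _ _
      map_comp φ ψ := Comma.mapOfEq_comp rfl rfl rfl _ _ _ _ _ _ }
  i := { app f := Comma.ofSquare (F := (toFunctor f.hom)) (K := 𝟭 f.right)
            (𝟭 f.left) (toFunctor f.hom) rfl
         naturality f g φ := Comma.comp_ofSquare (F := toFunctor f.hom) (K := 𝟭 f.right)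
            (F' := toFunctor g.hom) (K' := 𝟭 g.right) (a := φ.left) (b := φ.right) (c := φ.right)
            (s := 𝟭 f.left) (t := f.hom) (s' := 𝟭 g.left) (t' := g.hom) (r := φ.left)
            rfl rfl φ.w.symm rfl rfl φ.w }
  p := { app f := Comma.snd (toFunctor f.hom) (𝟭 f.right) }
  fac := rfl
  hi f := ⟨fun x y h => congrArg Comma.left h, Comma.isEquivalence_ofSquare_id _⟩
  hp f := Comma.snd_liftsMorphisms _

end Grpd

open MorphismProperty

/-! ### The 1-type model structure -/

namespace Cat

/-- The functors that are injective on objects. -/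
def injectiveOnObjects : MorphismProperty Cat.{u, u} :=
  fun _ _ f => Function.Injective f.toFunctor.obj

/-- The functors that induce an equivalence of free groupoids. -/
def weakOneEquivalences : MorphismProperty Cat.{u, u} :=
  Grpd.equivalences.inverseImage Grpd.free

lemma weakOneEquivalences_iff {C D : Cat.{u, u}} (f : C ⟶ D) :
    weakOneEquivalences f ↔ IsWeakOneEquivalence f.toFunctor :=
  (isWeakOneEquivalence_iff f.toFunctor).symm

instance : weakOneEquivalences.{u}.HasTwoOutOfThreeProperty :=
  inferInstanceAs (Grpd.equivalences.inverseImage Grpd.free).HasTwoOutOfThreeProperty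

instance : weakOneEquivalences.{u}.IsStableUnderRetracts :=
  inferInstanceAs (Grpd.equivalences.inverseImage Grpd.free).IsStableUnderRetracts

instance : injectiveOnObjects.{u}.IsStableUnderRetracts where
  of_retract {X Y Z W} f g h hg x y hxy := by
    have h₁ : ∀ x : X, (h.i.left ≫ g).toFunctor.obj x = (f ≫ h.i.right).toFunctor.obj x :=
      fun x => by rw [h.i_w]
    have h₂ : h.i.left.toFunctor.obj x = h.i.left.toFunctor.obj y :=
      hg ((h₁ x).trans ((congrArg h.i.right.toFunctor.obj hxy).trans (h₁ y).symm))
    have h₃ : ∀ x : X, h.r.left.toFunctor.obj (h.i.left.toFunctor.obj x) = x := fun x =>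
      Functor.congr_obj (congrArg Cat.Hom.toFunctor h.retract_left) x
    rw [← h₃ x, h₂, h₃]

lemma comm_toFunctor {f g : Arrow Cat.{u, u}} (φ : f ⟶ g) :
    f.hom.toFunctor ⋙ φ.right.toFunctor = φ.left.toFunctor ⋙ g.hom.toFunctor :=
  congrArg Cat.Hom.toFunctor φ.w.symm

/-- Functors factor through mapping cylinders. -/
def mappingCylinderFactorization : FunctorialFactorizationData injectiveOnObjects.{u}
    (injectiveOnObjects.rlp ⊓ weakOneEquivalences) where
  Z :=
    { obj f := Cat.of (MappingCylinder f.hom.toFunctor)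
      map φ := (MappingCylinder.map φ.left.toFunctor φ.right.toFunctor
        (comm_toFunctor φ)).toCatHom
      map_id f := Cat.ext (MappingCylinder.map_id (comm_toFunctor (𝟙 f)))
      map_comp φ ψ := Cat.ext (MappingCylinder.map_comp _ _ (comm_toFunctor φ) _ _
        (comm_toFunctor ψ) (comm_toFunctor (φ ≫ ψ))) }
  i := { app f := (MappingCylinder.incl f.hom.toFunctor).toCatHom
         naturality f g φ := Cat.ext (MappingCylinder.incl_comp_map _ _
          (comm_toFunctor φ)).symm }
  p := { app f := (MappingCylinder.proj f.hom.toFunctor).toCatHom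
         naturality f g φ := Cat.ext (MappingCylinder.map_comp_proj _ _
          (comm_toFunctor φ)) }
  fac := rfl
  hi f := MappingCylinder.incl_obj_injective _
  hp f := ⟨fun A B i hi => ⟨fun {s t} sq => by
      obtain ⟨l, h₁, h₂⟩ := MappingCylinder.exists_lift (i := i.toFunctor) hi
        (f := f.hom.toFunctor) (s := s.toFunctor) (t := t.toFunctor)
        (congrArg Cat.Hom.toFunctor sq.w.symm)
      exact ⟨⟨⟨l.toCatHom, Cat.ext h₁, Cat.ext h₂⟩⟩⟩⟩,
    FreeGroupoid.isEquivalence_map (MappingCylinder.proj f.hom.toFunctor)⟩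

lemma comm_freeGroupoid_map {f g : Arrow Cat.{u, u}} (φ : f ⟶ g) :
    FreeGroupoid.map f.hom.toFunctor ⋙ FreeGroupoid.map φ.right.toFunctor =
      FreeGroupoid.map φ.left.toFunctor ⋙ FreeGroupoid.map g.hom.toFunctor := by
  rw [← FreeGroupoid.map_comp, ← FreeGroupoid.map_comp, comm_toFunctor]

/-- Functors factor through mapping path categories over the free groupoid. -/
noncomputable def pathFactorization : FunctorialFactorizationData
    (injectiveOnObjects.{u} ⊓ weakOneEquivalences)
    (injectiveOnObjects ⊓ weakOneEquivalences).rlp where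
  Z :=
    { obj f := Cat.of (Comma (FreeGroupoid.map f.hom.toFunctor) (FreeGroupoid.of f.right))
      map φ := (Comma.mapOfEq (FreeGroupoid.map φ.left.toFunctor) φ.right.toFunctor
        (FreeGroupoid.map φ.right.toFunctor) (comm_freeGroupoid_map φ) rfl).toCatHom
      map_id f := Cat.ext (Comma.mapOfEq_id (FreeGroupoid.map_id _) rfl (FreeGroupoid.map_id _)
        (comm_freeGroupoid_map (𝟙 f)) rfl)
      map_comp φ ψ := Cat.ext (Comma.mapOfEq_comp
        (FreeGroupoid.map_comp φ.left.toFunctor ψ.left.toFunctor)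
        (show (φ ≫ ψ).right.toFunctor = φ.right.toFunctor ⋙ ψ.right.toFunctor from rfl)
        (FreeGroupoid.map_comp φ.right.toFunctor ψ.right.toFunctor)
        (comm_freeGroupoid_map φ) (FreeGroupoid.of_comp_map φ.right.toFunctor)
        (comm_freeGroupoid_map ψ) (FreeGroupoid.of_comp_map ψ.right.toFunctor)
        (comm_freeGroupoid_map (φ ≫ ψ)) (FreeGroupoid.of_comp_map (φ ≫ ψ).right.toFunctor)) }
  i := { app f := (Comma.ofSquare (F := FreeGroupoid.map f.hom.toFunctor)
            (K := FreeGroupoid.of f.right) (FreeGroupoid.of f.left) f.hom.toFunctor rfl).toCatHom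
         naturality f g φ := Cat.ext (Comma.comp_ofSquare
            (F := FreeGroupoid.map f.hom.toFunctor) (K := FreeGroupoid.of f.right)
            (F' := FreeGroupoid.map g.hom.toFunctor) (K' := FreeGroupoid.of g.right)
            (a := FreeGroupoid.map φ.left.toFunctor) (b := φ.right.toFunctor)
            (c := FreeGroupoid.map φ.right.toFunctor) (s := FreeGroupoid.of f.left)
            (t := f.hom.toFunctor) (s' := FreeGroupoid.of g.left) (t' := g.hom.toFunctor)
            (r := φ.left.toFunctor) rfl rfl (comm_freeGroupoid_map φ) rfl rfl
            (comm_toFunctor φ).symm) }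
  p := { app f := (Comma.snd (FreeGroupoid.map f.hom.toFunctor)
            (FreeGroupoid.of f.right)).toCatHom }
  fac := rfl
  hi f := ⟨fun x y h => FreeGroupoid.of_obj_bijective.1 (congrArg Comma.left h), by
    have := FreeGroupoid.isEquivalence_commaFst (FreeGroupoid.map f.hom.toFunctor)
    let ι := Comma.ofSquare (F := FreeGroupoid.map f.hom.toFunctor)
      (K := FreeGroupoid.of f.right) (FreeGroupoid.of f.left) f.hom.toFunctor rfl
    -- The inclusion is a section of the equivalence `commaFst` after passing to free groupoids,
    -- hence an equivalence itself.
    have h : FreeGroupoid.map ι ⋙ FreeGroupoid.commaFst _ = 𝟭 _ :=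
      (FreeGroupoid.map_comp_lift _ _).trans (FreeGroupoid.lift_unique _ (𝟭 _) rfl).symm
    have : (FreeGroupoid.map ι ⋙ FreeGroupoid.commaFst _).IsEquivalence := by
      rw [h]
      infer_instance
    exact Functor.isEquivalence_of_comp_right (FreeGroupoid.map ι) (FreeGroupoid.commaFst _)⟩
  hp f A B i hi := ⟨fun {s t} sq => by
    have : (FreeGroupoid.map i.toFunctor).IsEquivalence := hi.2
    obtain ⟨l, h₁, h₂⟩ := Comma.exists_lift_snd (i := i.toFunctor) hi.1
      (F := FreeGroupoid.map f.hom.toFunctor) (K := FreeGroupoid.of f.right)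
      (s := s.toFunctor) (t := t.toFunctor) (congrArg Cat.Hom.toFunctor sq.w.symm)
    exact ⟨⟨⟨l.toCatHom, Cat.ext h₁, Cat.ext h₂⟩⟩⟩⟩

/-- The 1-type model structure on small categories. -/
@[reducible]
noncomputable def oneTypeModelStructure : ModelCategory Cat.{u, u} :=
  ModelCategory.ofFunctorialFactorizations rfl mappingCylinderFactorization pathFactorization

lemma isOneTypeModelStructure : IsOneTypeModelStructure oneTypeModelStructure.{u} :=
  letI := oneTypeModelStructure.{u}
  { weakEquivalence_iff := fun f => (weakEquivalence_iff f).trans (weakOneEquivalences_iff f)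
    cofibration_iff := fun f => cofibration_iff f
    fibration_iff := fun f => (fibration_iff f).trans
      ⟨fun h _ _ i hi hw => h i ⟨hi, (weakOneEquivalences_iff i).2 hw⟩,
        fun h _ _ i hi => h i hi.1 ((weakOneEquivalences_iff i).1 hi.2)⟩ }

end Cat

/-! ### The Anderson model structure and the Quillen equivalence -/

namespace Grpd

/-- The Anderson model structure on groupoids. -/
@[reducible]
noncomputable def andersonModelStructure : ModelCategory Grpd.{u, u} :=
  ModelCategory.ofFunctorialFactorizations isofibrations_eq_rlp mappingCylinderFactorization
    pathFactorization

lemma isAndersonModelStructure : IsAndersonModelStructure andersonModelStructure.{u} :=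
  letI := andersonModelStructure.{u}
  { weakEquivalence_iff := fun f => weakEquivalence_iff f
    cofibration_iff := fun f => cofibration_iff f
    fibration_iff := fun f => (fibration_iff f).trans
      ⟨fun h => isofibrations_le_rlp f h _ pointToInfiniteSphere_mem,
        fun _ => mem_isofibrations_of_hasLiftingProperty f⟩ }

lemma injectiveOnObjects_free_map {C D : Cat.{u, u}} (f : C ⟶ D) (hf : Cat.injectiveOnObjects f) :
    injectiveOnObjects (free.map f) := fun x y h => by
  obtain ⟨x, rfl⟩ := FreeGroupoid.of_obj_bijective.2 x
  obtain ⟨y, rfl⟩ := FreeGroupoid.of_obj_bijective.2 y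
  exact congrArg _ (hf (FreeGroupoid.of_obj_bijective.1 h))

lemma isQuillenEquivalence_freeForgetAdjunction :
    letI := Cat.oneTypeModelStructure.{u}
    letI := andersonModelStructure.{u}
    IsQuillenEquivalence freeForgetAdjunction.{u} :=
  letI := Cat.oneTypeModelStructure.{u}
  letI := andersonModelStructure.{u}
  { map_cofibration := fun f hf => (cofibration_iff _).2
      (injectiveOnObjects_free_map f ((cofibration_iff _).1 hf))
    map_fibration := fun p hp => (fibration_iff _).2 fun _ _ i hi => by
      -- By adjunction, lifting `i` against the included `p` amounts to lifting its free groupoid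
      -- functor, an injective equivalence, against `p`.
      rw [← freeForgetAdjunction.hasLiftingProperty_iff]
      exact isofibrations_le_rlp p ((fibration_iff _).1 hp) _
        ⟨injectiveOnObjects_free_map i hi.1, hi.2⟩
    weakEquivalence_iff := fun X Y _ _ f => by
      -- The adjoint map is the free groupoid functor of `f` followed by the counit, an isomorphism
      -- because groupoids are reflective.
      rw [weakEquivalence_iff, weakEquivalence_iff, Adjunction.homEquiv_counit]
      exact ((equivalences.{u}).cancel_right_of_respectsIso _ _).symm }

end Grpd

end CategoryTheory

theorem mainTheorem8 :
    ∃ (M : ModelCategory Cat.{u, u}) (N : ModelCategory Grpd.{u, u}),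
      IsBicompleteFunctorialModel Cat.{u, u} ∧ IsOneTypeModelStructure M ∧
      IsBicompleteFunctorialModel Grpd.{u, u} ∧ IsAndersonModelStructure N ∧
      IsQuillenEquivalence Grpd.freeForgetAdjunction.{u} :=
  ⟨Cat.oneTypeModelStructure, Grpd.andersonModelStructure,
    ModelCategory.isBicompleteFunctorialModel_of _ _ _, Cat.isOneTypeModelStructure,
    ModelCategory.isBicompleteFunctorialModel_of _ _ _, Grpd.isAndersonModelStructure,
    Grpd.isQuillenEquivalence_freeForgetAdjunction⟩
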